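/- **Setting.** Let $\mathcal I=\{1,\dots,d\}$, let $\sigma$ be the left shift on $\mathcal I^{\mathbb Z}$ (product topology), and let $\Lambda\subseteq\mathcal I^{\mathbb Z}$ be a subshift, i.e. a closed set with $\sigma(\Lambda)=\Lambda$. For $k\in\mathbb N$ (including $0$), $\Lambda$ is a *$k$-step subshift of finite type* if there is a finite set $W$ of words of length at most $k+1$ such that $\Lambda$ is the set of all $x\in\mathcal I^{\mathbb Z}$ in which no word of $W$ occurs as a block. Let $\Lambda^n$ be the set of words of length $n$ occurring in elements of $\Lambda$, let $\Lambda^*=\bigcup_{n\ge 0}\Lambda^n$, and for $i\in\mathcal I$ let $E_i^k=\{\alpha\in\Lambda^k : i\alpha\in\Lambda^*\}$. Let $E=\mathbb C^d$ with orthonormal basis $e_1,\dots,e_d$, and write $e_\alpha=e_{\alpha_1}\otimes\cdots\otimes e_{\alpha_n}\in E^{\otimes n}$ for a word $\alpha=\alpha_1\cdots\alpha_n$. Put $X(0)=\mathbb C$, $X(n)=\mathrm{span}\{e_\alpha:\alpha\in\Lambda^n\}\subseteq E^{\otimes n}$ for $n\ge1$, and let $\mathfrak F_X=\bigoplus_{n\ge0}X(n)$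 be the Hilbert space direct sum. For $i\in\mathcal I$ let $S_i\in B(\mathfrak F_X)$ be the operator with $S_ix=p_{n+1}(e_i\otimes x)$ for $x\in X(n)$, where $p_{n+1}$ is the orthogonal projection of $E^{\otimes (n+1)}$ onto $X(n+1)$. Let $\mathcal T_X$ be the C$^*$-algebra generated by $S_1,\dots,S_d$ and the identity, let $\mathcal O_\Lambda=\mathcal T_X/\mathcal K(\mathfrak F_X)$ be its quotient by the compact operators (Matsumoto's algebra of $\Lambda$), and let $Z_i\in\mathcal O_\Lambda$ be the class of $S_i$. Finally let $I^{X_\Lambda}$ be the linear span of all noncommutative polynomials $p=\sum_\alpha c_\alpha x^\alpha\in\mathbb C\langle x_1,\dots,x_d\rangle$ such that, for some $n>0$, $p(e):=\sum_\alpha c_\alpha e_\alpha$ lies in $E^{\otimes n}\ominus X(n)$. **Theorem.** Let $\Lambda$ be a $k$-step subshift of finite type and let $H$ be a complex Hilbert space. For $\underline T=(T_1,\dots,T_d)\in B(H)^d$ consider the relations $$\text{(Z1)}\quad p(\underline T)=0\ \text{ for all } p\in I^{X_\Lambda};\qquad \text{(Z2)}\quad T_i^*T_j=0\ \text{ for all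 } i\neq j;$$ $$\text{(Z3)}\quad \sum_{i=1}^d T_iT_i^*=1;\qquad \text{(Z4)}\quad T_i^*T_i=\sum_{\alpha\in E_i^k}\underline T^\alpha\,\underline T^{\alpha*}\ \text{ for all } i,$$ where $\underline T^\alpha=T_{\alpha_1}\cdots T_{\alpha_n}$ for $\alpha=\alpha_1\cdots\alpha_n$ (and $\underline T^\alpha=1$ for the empty word). 1. If $\pi:\mathcal O_\Lambda\to B(H)$ is a unital $*$-representation, then $T_i:=\pi(Z_i)$, $i=1,\dots,d$, is a row contraction (that is, $\sum_iT_iT_i^*\le 1$) satisfying (Z1)–(Z4), and $\pi$ is determined by it: two unital $*$-representations of $\mathcal O_\Lambda$ on $H$ that agree on $Z_1,\dots,Z_d$ are equal. 2. Conversely, for every row contraction $(T_1,\dots,T_d)\in B(H)^d$ satisfying (Z1)–(Z4) there is a unital $*$-representation $\pi:\mathcal O_\Lambda\to B(H)$ such that $\pi(Z_i)=T_i$ for all $i$. -/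

import Mathlib

noncomputable section

namespace SubshiftAlgebra

/-! ### Subshifts over the alphabet `Fin d` -/

/-- The left shift on two-sided sequences, `(σ x) k = x (k + 1)`. -/
def shift {d : ℕ} (x : ℤ → Fin d) : ℤ → Fin d := fun k => x (k + 1)

/-- A subshift: a closed subset `Λ` of the product space `(Fin d)^ℤ` with `σ(Λ) = Λ`. -/
structure Subshift (d : ℕ) where
  carrier : Set (ℤ → Fin d)
  isClosed : IsClosed carrier
  shift_image : shift '' carrier = carrier

/-- The word `w` occurs as a block in the two-sided sequence `x`. -/
def Occurs {d : ℕ} (w : List (Fin d)) (x : ℤ → Fin d) : Prop :=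
  ∃ m : ℤ, ∀ j : Fin w.length, x (m + (j : ℕ)) = w.get j

/-- `Λ_W`: the sequences in which no word of `W` occurs. -/
def avoiding {d : ℕ} (W : Set (List (Fin d))) : Set (ℤ → Fin d) :=
  {x | ∀ w ∈ W, ¬ Occurs w x}

/-- `Λ` is a `k`-step subshift of finite type: it is given by a finite set of forbidden words of
length at most `k + 1`. -/
def Subshift.IsStepSFT {d : ℕ} (Λ : Subshift d) (k : ℕ) : Prop :=
  ∃ W : Set (List (Fin d)), W.Finite ∧ (∀ w ∈ W, w.length ≤ k + 1) ∧ Λ.carrier = avoiding W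

/-- `Λ^n`: the words of length `n` occurring in some `x ∈ Λ`. -/
def Subshift.words {d : ℕ} (Λ : Subshift d) (n : ℕ) : Set (List (Fin d)) :=
  {α | α.length = n ∧ ∃ x ∈ Λ.carrier, Occurs α x}

/-- `Λ^* = ⋃ₙ Λ^n`. -/
def Subshift.language {d : ℕ} (Λ : Subshift d) : Set (List (Fin d)) :=
  ⋃ n : ℕ, Λ.words n

/-- `E_i^k`: the words `α ∈ Λ^k` such that `iα ∈ Λ^*`. -/
def Subshift.followers {d : ℕ} (Λ : Subshift d) (i : Fin d) (k : ℕ) : Set (List (Fin d)) :=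
  {α | α ∈ Λ.words k ∧ i :: α ∈ Λ.language}

theorem Subshift.finite_followers {d : ℕ} (Λ : Subshift d) (i : Fin d) (k : ℕ) :
    (Λ.followers i k).Finite :=
  (List.finite_length_eq (Fin d) k).subset fun _ h => h.1.1

/-! ### The full Fock space of `E = ℂ^d` and its standard shift -/

/-- The full Fock space `⨁ₙ E^{⊗n}` of `E = ℂ^d`, realised as `ℓ²` of the set of all words: the
word `α = α₁⋯αₙ` indexes the orthonormal basis vector `e_α = e_{α₁} ⊗ ⋯ ⊗ e_{αₙ}`. -/
abbrev Fock (d : ℕ) : Type := lp (fun _ : List (Fin d) => ℂ) 2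

/-- The basis vector `e_α` of the full Fock space; `e_[]` is the vacuum vector. -/
def e {d : ℕ} (α : List (Fin d)) : Fock d := lp.single 2 α (1 : ℂ)

theorem orthonormal_e (d : ℕ) : Orthonormal ℂ (e : List (Fin d) → Fock d) := by
  classical
  rw [orthonormal_iff_ite]
  intro α β
  simp only [e, lp.inner_single_left, lp.single_apply, Pi.single_apply]
  split_ifs <;> simp

/-- The subspace `E^{⊗n}` of the full Fock space (the `n` particle space). -/
def tensorPower (d n : ℕ) : Submodule ℂ (Fock d) :=
  Submodule.span ℂ (e '' {α : List (Fin d) | α.length = n})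

theorem orthonormal_e_cons {d : ℕ} (i : Fin d) :
    Orthonormal ℂ (fun α : List (Fin d) => e (i :: α)) :=
  (orthonormal_e d).comp (fun α : List (Fin d) => i :: α) (List.cons_injective)

/-- The left creation operator `S_i x = e_i ⊗ x` on the full Fock space: the isometry that maps
`e_α` to `e_{iα}`. -/
def creation {d : ℕ} (i : Fin d) : Fock d →L[ℂ] Fock d :=
  (orthonormal_e_cons i).orthogonalFamily.linearIsometry.toContinuousLinearMap

theorem creation_e {d : ℕ} (i : Fin d) (α : List (Fin d)) : creation i (e α) = e (i :: α) := by
  classical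
  unfold creation
  conv_lhs => rw [e]
  simp [OrthogonalFamily.linearIsometry_apply_single]

/-! ### The subproduct system, its Fock space and its shift -/

/-- The fibres of the subproduct system of the subshift `Λ`: `X(0) = ℂ` (spanned by the vacuum) and
`X(n) = span {e_α : α ∈ Λ^n} ⊆ E^{⊗n}` for `n ≥ 1`. -/
def Subshift.fibre {d : ℕ} (Λ : Subshift d) (n : ℕ) : Submodule ℂ (Fock d) :=
  if n = 0 then Submodule.span ℂ {e []} else Submodule.span ℂ (e '' Λ.words n)

/-- The `X`-Fock space `𝔉_X`, i.e. the Hilbert space direct sum of the fibres `X(n)`, as a closed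
subspace of the full Fock space. -/
def Subshift.fockSubspace {d : ℕ} (Λ : Subshift d) : Submodule ℂ (Fock d) :=
  (⨆ n : ℕ, Λ.fibre n).topologicalClosure

/-- The `X`-Fock space `𝔉_X` as a Hilbert space. -/
def Subshift.FockSpace {d : ℕ} (Λ : Subshift d) : Type := Λ.fockSubspace

instance {d : ℕ} (Λ : Subshift d) : NormedAddCommGroup Λ.FockSpace :=
  inferInstanceAs (NormedAddCommGroup Λ.fockSubspace)

instance {d : ℕ} (Λ : Subshift d) : InnerProductSpace ℂ Λ.FockSpace :=
  inferInstanceAs (InnerProductSpace ℂ Λ.fockSubspace)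

instance {d : ℕ} (Λ : Subshift d) : CompleteSpace Λ.FockSpace :=
  (Submodule.isClosed_topologicalClosure (⨆ n : ℕ, Λ.fibre n)).completeSpace_coe

/-- The isometric inclusion of the `X`-Fock space into the full Fock space. -/
def Subshift.incl {d : ℕ} (Λ : Subshift d) : Λ.FockSpace →L[ℂ] Fock d :=
  Λ.fockSubspace.subtypeL

/-- The standard `X`-shift `S_i x = U_{1,n}(e_i ⊗ x)` for `x ∈ X(n)`. The multiplication `U_{1,n}`
of `X` is the restriction of the orthogonal projection onto `X(n + 1)`, so `S_i` is the compression
of the creation operator to the `X`-Fock space; the adjoint of the inclusion is the orthogonal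
projection onto the `X`-Fock space. -/
def Subshift.shiftOp {d : ℕ} (Λ : Subshift d) (i : Fin d) : Λ.FockSpace →L[ℂ] Λ.FockSpace :=
  Λ.incl.adjoint ∘L creation i ∘L Λ.incl

/-! ### The Toeplitz algebra and the algebra of the subshift -/

/-- The Toeplitz algebra `𝒯_X`: the C⋆-algebra generated by the `X`-shift and the identity. -/
def Subshift.toeplitz {d : ℕ} (Λ : Subshift d) : StarSubalgebra ℂ (Λ.FockSpace →L[ℂ] Λ.FockSpace) :=
  (StarAlgebra.adjoin ℂ (Set.range Λ.shiftOp)).topologicalClosure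

/-- The adjoint of a compact operator is compact. -/
theorem isCompactOperator_star {F : Type*} [NormedAddCommGroup F] [InnerProductSpace ℂ F]
    [CompleteSpace F] {K : F →L[ℂ] F} (hK : IsCompactOperator K) :
    IsCompactOperator (star K : F →L[ℂ] F) := by
  have hKK : IsCompactOperator (K ∘L star K) := hK.comp_clm (star K)
  have key : ∀ x y : F, ‖x‖ ≤ 1 → ‖y‖ ≤ 1 →
      ‖star K x - star K y‖ ^ 2 ≤ 2 * ‖(K ∘L star K) x - (K ∘L star K) y‖ := by
    intro x y hx hy
    have h1 : ‖star K (x - y)‖ ^ 2 = RCLike.re (inner ℂ ((K ∘L star K) (x - y)) (x - y)) := by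
      rw [← inner_self_eq_norm_sq (𝕜 := ℂ)]
      congr 1
      rw [ContinuousLinearMap.star_eq_adjoint, ContinuousLinearMap.adjoint_inner_right]
      rfl
    rw [← map_sub, ← map_sub, h1]
    refine (re_inner_le_norm _ _).trans ?_
    rw [mul_comm]
    refine mul_le_mul_of_nonneg_right ?_ (norm_nonneg _)
    exact (norm_sub_le x y).trans (by linarith)
  have htb : TotallyBounded ((K ∘L star K) '' Metric.closedBall 0 1) :=
    (hKK.isCompact_closure_image_closedBall 1).totallyBounded.subset subset_closure
  refine (isCompactOperator_iff_isCompact_closure_image_closedBall ((star K : F →L[ℂ] F) : F →ₗ[ℂ] F)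
    one_pos).2 ?_
  refine TotallyBounded.isCompact_of_isClosed (TotallyBounded.closure ?_) isClosed_closure
  rw [Metric.totallyBounded_iff]
  intro ε hε
  obtain ⟨t, hts, htf, hcov⟩ := Metric.finite_approx_of_totallyBounded htb (ε ^ 2 / 2)
    (by positivity)
  obtain ⟨u, huB, huf, rfl⟩ := Set.exists_subset_image_finite_and.1 ⟨t, hts, htf, rfl⟩
  refine ⟨(star K : F →L[ℂ] F) '' u, huf.image _, ?_⟩
  rintro _ ⟨x, hx, rfl⟩
  obtain ⟨_, ⟨y, hy, rfl⟩, hxy⟩ := Set.mem_iUnion₂.1 (hcov ⟨x, hx, rfl⟩)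
  refine Set.mem_iUnion₂.2 ⟨_, ⟨y, hy, rfl⟩, ?_⟩
  rw [Metric.mem_ball, dist_eq_norm] at hxy ⊢
  have h1 := key x y (by simpa using hx) (by simpa using huB hy)
  have h2 : ‖star K x - star K y‖ ^ 2 < ε ^ 2 := by linarith
  exact lt_of_pow_lt_pow_left₀ 2 hε.le h2

/-- The compact operators belonging to `𝒯_X`, as an ideal of `𝒯_X`. -/
def Subshift.compacts {d : ℕ} (Λ : Subshift d) : Ideal Λ.toeplitz where
  carrier := {a | IsCompactOperator (a : Λ.FockSpace →L[ℂ] Λ.FockSpace)}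
  add_mem' ha hb := ha.add hb
  zero_mem' := isCompactOperator_zero
  smul_mem' c _ ha := ha.clm_comp (c : Λ.FockSpace →L[ℂ] Λ.FockSpace)

instance Subshift.isTwoSided_compacts {d : ℕ} (Λ : Subshift d) : Λ.compacts.IsTwoSided where
  mul_mem_of_left b ha := IsCompactOperator.comp_clm ha (b : Λ.FockSpace →L[ℂ] Λ.FockSpace)

/-- The algebra `𝒪_Λ = 𝒯_X / 𝒦(𝔉_X)` of the subshift. -/
abbrev Subshift.algebra {d : ℕ} (Λ : Subshift d) : Type := Λ.toeplitz ⧸ Λ.compacts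

theorem Subshift.star_mem_compacts {d : ℕ} (Λ : Subshift d) {a : Λ.toeplitz}
    (ha : a ∈ Λ.compacts) : star a ∈ Λ.compacts :=
  isCompactOperator_star ha

/-- The involution of `𝒪_Λ` induced by the adjoint. -/
instance Subshift.starRingAlgebra {d : ℕ} (Λ : Subshift d) : StarRing Λ.algebra where
  star := Quotient.map' star fun a b h => by
    rw [Submodule.quotientRel_def] at h ⊢
    have := Λ.star_mem_compacts h
    rwa [star_sub] at this
  star_involutive := by
    rintro ⟨a⟩
    exact congrArg (Ideal.Quotient.mk Λ.compacts) (star_star a)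
  star_mul := by
    rintro ⟨a⟩ ⟨b⟩
    exact congrArg (Ideal.Quotient.mk Λ.compacts) (star_mul a b)
  star_add := by
    rintro ⟨a⟩ ⟨b⟩
    exact congrArg (Ideal.Quotient.mk Λ.compacts) (star_add a b)

theorem Subshift.star_mk {d : ℕ} (Λ : Subshift d) (a : Λ.toeplitz) :
    star (Ideal.Quotient.mk Λ.compacts a) = Ideal.Quotient.mk Λ.compacts (star a) := rfl

instance Subshift.starModuleAlgebra {d : ℕ} (Λ : Subshift d) : StarModule ℂ Λ.algebra where
  star_smul := by
    rintro c ⟨a⟩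
    exact congrArg (Ideal.Quotient.mk Λ.compacts) (star_smul c a)

theorem Subshift.shiftOp_mem_toeplitz {d : ℕ} (Λ : Subshift d) (i : Fin d) :
    Λ.shiftOp i ∈ Λ.toeplitz :=
  StarSubalgebra.le_topologicalClosure _ (StarAlgebra.subset_adjoin ℂ _ ⟨i, rfl⟩)

/-- The generator `Z_i` of `𝒪_Λ`: the class of `S_i`. -/
def Subshift.Z {d : ℕ} (Λ : Subshift d) (i : Fin d) : Λ.algebra :=
  Ideal.Quotient.mk Λ.compacts ⟨Λ.shiftOp i, Λ.shiftOp_mem_toeplitz i⟩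

/-! ### The relations -/

/-- `p(e) = ∑ c_α e_α` for a noncommutative polynomial `p = ∑ c_α x^α`. -/
def evalBasis (d : ℕ) : FreeAlgebra ℂ (Fin d) →ₗ[ℂ] Fock d :=
  (FreeAlgebra.basisFreeMonoid ℂ (Fin d)).constr ℂ fun α : FreeMonoid (Fin d) => e α.toList

/-- The ideal `I^X`, i.e. the span of the noncommutative polynomials `p` for which there is some
`n > 0` with `p(e) ∈ E^{⊗n} ⊖ X(n)`. -/
def Subshift.polyIdeal {d : ℕ} (Λ : Subshift d) : Submodule ℂ (FreeAlgebra ℂ (Fin d)) :=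
  Submodule.span ℂ {p | ∃ n : ℕ, 0 < n ∧ evalBasis d p ∈ tensorPower d n ⊓ (Λ.fibre n)ᗮ}

/-- `T^α = T_{α₁} ⋯ T_{αₙ}`. -/
def wordProd {A : Type*} [Monoid A] {d : ℕ} (T : Fin d → A) (α : List (Fin d)) : A :=
  (α.map T).prod

/-- The relations satisfied by the generators of the algebra of a `k`-step subshift of finite
type. -/
structure Subshift.Relations {d : ℕ} (Λ : Subshift d) (k : ℕ) {A : Type*} [Ring A] [StarRing A]
    [Algebra ℂ A] (T : Fin d → A) : Prop where
  z1 : ∀ p ∈ Λ.polyIdeal, FreeAlgebra.lift ℂ T p = 0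
  z2 : ∀ i j, i ≠ j → star (T i) * T j = 0
  z3 : ∑ i, T i * star (T i) = 1
  z4 : ∀ i, star (T i) * T i =
    ∑ α ∈ (Λ.finite_followers i k).toFinset, wordProd T α * star (wordProd T α)

/-- `(T_1, …, T_d)` is a row contraction: `∑ T_i T_i^* ≤ 1`. -/
def IsRowContraction {H : Type*} [NormedAddCommGroup H] [InnerProductSpace ℂ H] [CompleteSpace H]
    {d : ℕ} (T : Fin d → H →L[ℂ] H) : Prop :=
  ∑ i, T i * star (T i) ≤ 1

end SubshiftAlgebra

end

/-!
Let `f_α` be the basis vector `e_α` of the `X`-Fock space if `α` is admissible (empty or in `Λ^*`),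
and `0` otherwise. Then `S_i f_α = f_{iα}`, and `S_i^*` removes the letter `i`. Hence `S_i^* S_j = 0`
for `i ≠ j`, `S^α = 0` for inadmissible `α`, and the remaining two relations hold on all `f_α` with
`|α| ≥ k` (or `|α| ≥ 1`), so they hold modulo operators of finite rank; for the last one, the
gluing property `IsStepSFT.cons_mem_language` says that `iα ∈ Λ^*` depends only on the first `k`
letters of `α ∈ Λ^*`. A representation is determined by its values on the generators because
representations of the C⋆-algebra `𝒯_X` are automatically continuous.

For the converse, let `T` satisfy the relations. Since `T_i^* T_i` is a projection and a partial sum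
of `∑_{|α| = k} T^α T^α* = 1`, positivity forces `T_i^* T_i T^α` to be `T^α` or `0` according to
whether `iα` is admissible, for all `|α| ≥ k` (`Relations.star_mul_self_mul_wordProd`). Therefore
the isometries `V_n h = ∑_{|α| = n} f_α ⊗ T^α* h` of `H` into `𝔉_X ⊗ H`, which have mutually
orthogonal ranges, satisfy `(S_i ⊗ 1) V_n = V_{n+1} T_i` for `n ≥ k` and
`(S_i^* ⊗ 1) V_{n+1} = V_n T_i^*`. The averaged isometries `K_N = (N+1)^{-1/2} ∑_{n ≤ N} V_n` then
satisfy `(S_i ⊗ 1) K_N - K_N T_i → 0` and `(S_i^* ⊗ 1) K_N - K_N T_i^* → 0` strongly, as the sums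
telescope up to boundedly many terms.

The pairs `(a, T)` with `(a ⊗ 1) K_N - K_N T → 0`, and likewise for the adjoints, form a closed
⋆-algebra in which `‖T‖ ≤ ‖a‖`. Its projection to the first coordinate is thus isometric with closed
range, which contains `𝒯_X`; inverting it gives a representation of `𝒯_X` with `S_i ↦ T_i`
(`exists_hom_of_asympIntertwines`). Rank one operators, and with them all compact operators, are
intertwined with `0` because `K_N` spreads its mass over `N + 1` degrees, so the representation
descends to `𝒪_Λ`.
-/

noncomputable section

namespace SubshiftAlgebra

/-! ### Words of a subshift of finite type -/

section Words

variable {d : ℕ} (Λ : Subshift d)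

theorem occurs_iff {w : List (Fin d)} {x : ℤ → Fin d} :
    Occurs w x ↔ ∃ m : ℤ, ∀ (j : ℕ) (hj : j < w.length), x (m + j) = w[j] :=
  ⟨fun ⟨m, h⟩ => ⟨m, fun j hj => h ⟨j, hj⟩⟩, fun ⟨m, h⟩ => ⟨m, fun j => h j j.2⟩⟩

theorem Subshift.mem_language {α : List (Fin d)} :
    α ∈ Λ.language ↔ ∃ x ∈ Λ.carrier, Occurs α x := by
  simp [Subshift.language, Subshift.words]

theorem Subshift.mem_words {n : ℕ} {α : List (Fin d)} :
    α ∈ Λ.words n ↔ α.length = n ∧ α ∈ Λ.language := by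
  rw [Λ.mem_language]; rfl

theorem Subshift.language_of_append {α β : List (Fin d)} (h : α ++ β ∈ Λ.language) :
    α ∈ Λ.language ∧ β ∈ Λ.language := by
  simp only [Λ.mem_language, occurs_iff] at h ⊢
  obtain ⟨x, hx, m, hm⟩ := h
  refine ⟨⟨x, hx, m, fun j hj => ?_⟩, ⟨x, hx, m + α.length, fun j hj => ?_⟩⟩
  · rw [hm j (by simp; omega), List.getElem_append_left hj]
  · have := hm (α.length + j) (by simp; omega)
    rw [List.getElem_append_right (by omega)] at this
    simpa [add_assoc] using this

/-- The words that index the canonical basis of the `X`-Fock space: those of `Λ^*`, together with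
the empty word, which lies outside `Λ^*` when `Λ` is empty although `X(0) = ℂ` in any case. -/
def Subshift.admissible : Set (List (Fin d)) := {α | α = [] ∨ α ∈ Λ.language}

theorem Subshift.nil_mem_admissible : [] ∈ Λ.admissible := Or.inl rfl

theorem Subshift.cons_mem_admissible {i : Fin d} {α : List (Fin d)} :
    i :: α ∈ Λ.admissible ↔ i :: α ∈ Λ.language := by
  simp [Subshift.admissible]

theorem Subshift.admissible_of_append {α β : List (Fin d)} (h : α ++ β ∈ Λ.admissible) :
    α ∈ Λ.admissible ∧ β ∈ Λ.admissible := by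
  rcases h with h | h
  · obtain ⟨rfl, rfl⟩ := List.append_eq_nil_iff.1 h
    exact ⟨Or.inl rfl, Or.inl rfl⟩
  · exact ⟨Or.inr (Λ.language_of_append h).1, Or.inr (Λ.language_of_append h).2⟩

theorem Subshift.admissible_of_cons {i : Fin d} {α : List (Fin d)} (h : i :: α ∈ Λ.admissible) :
    α ∈ Λ.admissible :=
  (Λ.admissible_of_append (α := [i]) h).2

variable {Λ}

/-- The defining property of a `k`-step subshift: two words that overlap in `k` letters can be
glued. The glued sequence agrees with an occurrence of `i α₁⋯α_k` up to position `k` and with an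
occurrence of `α` from position `1` on, and every block of length `k + 1` lies in one of the two
halves. -/
theorem Subshift.IsStepSFT.cons_mem_language {k : ℕ} (hΛ : Λ.IsStepSFT k) {i : Fin d}
    {α : List (Fin d)} (hα : α ∈ Λ.language) (hk : k ≤ α.length)
    (hi : i :: α.take k ∈ Λ.language) : i :: α ∈ Λ.language := by
  obtain ⟨W, -, hW, hΛW⟩ := hΛ
  simp only [Λ.mem_language, occurs_iff, hΛW] at hα hi ⊢
  obtain ⟨x, hx, m, hm⟩ := hα
  obtain ⟨y, hy, p, hp⟩ := hi
  let z : ℤ → Fin d := fun t => if t ≤ 0 then y (p + t) else x (m + t - 1)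
  have hzx : ∀ t : ℤ, 1 ≤ t → z t = x (m + t - 1) := fun t ht => if_neg (by omega)
  have hzy : ∀ t : ℤ, t ≤ k → z t = y (p + t) := by
    intro t ht
    by_cases h0 : t ≤ 0
    · exact if_pos h0
    · obtain ⟨j, rfl⟩ : ∃ j : ℕ, t = j + 1 := ⟨(t - 1).toNat, by omega⟩
      have hj : j < k := by omega
      have h1 := hp (j + 1) (by simp; omega)
      have h2 := hm j (by omega)
      rw [hzx _ (by omega)]
      simp only [List.getElem_cons_succ, List.getElem_take] at h1
      rw [← h2] at h1
      push_cast at h1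
      rw [h1]
      congr 1
      ring
  refine ⟨z, ?_, 0, ?_⟩
  · intro w hw hz
    obtain ⟨s, hs⟩ := occurs_iff.1 hz
    have hwk := hW w hw
    by_cases h1 : 1 ≤ s
    · refine hx w hw (occurs_iff.2 ⟨m + s - 1, fun j hj => ?_⟩)
      rw [← hs j hj, hzx _ (by omega)]
      congr 1
      ring
    · refine hy w hw (occurs_iff.2 ⟨p + s, fun j hj => ?_⟩)
      rw [← hs j hj, hzy _ (by omega)]
      congr 1
      ring
  · rintro (_ | j) hj
    · have h1 := hp 0 (by simp)
      have h2 := hzy 0 (by omega)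
      simp only [List.getElem_cons_zero, Nat.cast_zero, add_zero] at h1 h2 ⊢
      rw [h2, h1]
    · have h2 := hm j (by simpa using hj)
      simp only [List.getElem_cons_succ, zero_add]
      rw [hzx _ (by omega), ← h2]
      congr 1
      push_cast
      ring

theorem Subshift.IsStepSFT.take_mem_followers {k : ℕ} (hΛ : Λ.IsStepSFT k) {i : Fin d}
    {α : List (Fin d)} (hα : α ∈ Λ.admissible) (hk : k ≤ α.length) :
    α.take k ∈ Λ.followers i k ↔ i :: α ∈ Λ.admissible := by
  rw [Λ.cons_mem_admissible]
  constructor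
  · rintro ⟨-, h⟩
    rcases hα with rfl | hα
    · simpa using h
    · exact hΛ.cons_mem_language hα hk h
  · intro h
    have h1 : i :: α.take k ∈ Λ.language :=
      (Λ.language_of_append (α := i :: α.take k) (β := α.drop k) (by simpa using h)).1
    exact ⟨Λ.mem_words.2 ⟨by simpa using hk, (Λ.language_of_append (α := [i]) h1).2⟩, h1⟩

end Words

/-! ### Sums over the words of a given length -/

section WordSums

/-- All words of length `n` over the alphabet `Fin d`. -/
def allWords (d n : ℕ) : Finset (List (Fin d)) := (List.finite_length_eq (Fin d) n).toFinset

@[simp]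
theorem mem_allWords {d n : ℕ} {α : List (Fin d)} : α ∈ allWords d n ↔ α.length = n := by
  simp [allWords]

theorem allWords_zero (d : ℕ) : allWords d 0 = {[]} := by
  ext α; simp

theorem sum_allWords_succ {d : ℕ} {M : Type*} [AddCommMonoid M] (n : ℕ) (g : List (Fin d) → M) :
    ∑ α ∈ allWords d (n + 1), g α = ∑ i, ∑ α ∈ allWords d n, g (i :: α) := by
  rw [← Finset.sum_product']
  symm
  refine Finset.sum_bij (fun p _ => p.1 :: p.2) ?_ ?_ ?_ ?_
  · simp
  · rintro ⟨i, α⟩ - ⟨j, β⟩ - h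
    simpa using h
  · rintro (_ | ⟨i, α⟩) h
    · simp at h
    · exact ⟨(i, α), by simpa using h, rfl⟩
  · simp

variable {A : Type*} [Monoid A] {d : ℕ} (T : Fin d → A)

@[simp]
theorem wordProd_nil : wordProd T [] = 1 := rfl

@[simp]
theorem wordProd_cons (i : Fin d) (α : List (Fin d)) :
    wordProd T (i :: α) = T i * wordProd T α := by
  simp [wordProd]

theorem wordProd_append (α β : List (Fin d)) :
    wordProd T (α ++ β) = wordProd T α * wordProd T β := by
  simp [wordProd]

theorem map_wordProd {B F : Type*} [Monoid B] [FunLike F A B] [MonoidHomClass F A B] (φ : F)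
    (α : List (Fin d)) : φ (wordProd T α) = wordProd (fun i => φ (T i)) α := by
  simp only [wordProd, map_list_prod, List.map_map]
  rfl

end WordSums

/-! ### The canonical basis of the Fock space and the shift operators -/

section FockBasis

variable {d : ℕ} (Λ : Subshift d)

/-- The orthogonal projection of `e_α` to the `X`-Fock space: the basis vector `e_α` if `α` is
admissible, and `0` otherwise. -/
def Subshift.basisVec (α : List (Fin d)) : Λ.FockSpace := Λ.incl.adjoint (e α)

theorem Subshift.inner_basisVec_left (α : List (Fin d)) (y : Λ.FockSpace) :
    inner ℂ (Λ.basisVec α) y = (Λ.incl y : Fock d) α := by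
  rw [Subshift.basisVec, ContinuousLinearMap.adjoint_inner_left, e, lp.inner_single_left]
  simp

theorem inner_e (α β : List (Fin d)) [Decidable (α = β)] :
    inner ℂ (e α) (e β : Fock d) = if α = β then 1 else 0 := by
  classical
  convert! orthonormal_iff_ite.1 (orthonormal_e d) α β

theorem Subshift.fockSubspace_le {α : List (Fin d)} (hα : α ∉ Λ.admissible) :
    Λ.fockSubspace ≤ (Submodule.span ℂ {(e α : Fock d)})ᗮ := by
  classical
  refine Submodule.topologicalClosure_minimal _ (iSup_le fun n => ?_)
    (Submodule.isClosed_orthogonal _)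
  unfold Subshift.fibre
  split_ifs with hn
  · rw [Submodule.span_le]
    rintro _ rfl
    rw [SetLike.mem_coe, Submodule.mem_orthogonal_singleton_iff_inner_right, inner_e, if_neg]
    rintro rfl
    exact hα Λ.nil_mem_admissible
  · rw [Submodule.span_le]
    rintro _ ⟨β, hβ, rfl⟩
    rw [SetLike.mem_coe, Submodule.mem_orthogonal_singleton_iff_inner_right, inner_e, if_neg]
    rintro rfl
    exact hα (Or.inr (Λ.mem_words.1 hβ).2)

theorem Subshift.e_mem_fockSubspace {α : List (Fin d)} (hα : α ∈ Λ.admissible) :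
    (e α : Fock d) ∈ Λ.fockSubspace := by
  refine Submodule.le_topologicalClosure _ (Submodule.mem_iSup_of_mem α.length ?_)
  unfold Subshift.fibre
  split_ifs with hn
  · obtain rfl := List.length_eq_zero_iff.1 hn
    exact Submodule.mem_span_singleton_self _
  · rcases hα with rfl | hα
    · simp at hn
    · exact Submodule.subset_span ⟨α, Λ.mem_words.2 ⟨rfl, hα⟩, rfl⟩

theorem Subshift.inner_incl (x y : Λ.FockSpace) :
    inner ℂ (Λ.incl x) (Λ.incl y) = inner ℂ x y := rfl

theorem Subshift.adjoint_incl_incl (x : Λ.FockSpace) : Λ.incl.adjoint (Λ.incl x) = x := by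
  refine ext_inner_right ℂ fun y => ?_
  rw [ContinuousLinearMap.adjoint_inner_left, Λ.inner_incl]

theorem Subshift.basisVec_of_notMem {α : List (Fin d)} (hα : α ∉ Λ.admissible) :
    Λ.basisVec α = 0 := by
  refine ext_inner_right ℂ fun y => ?_
  rw [Subshift.basisVec, ContinuousLinearMap.adjoint_inner_left, inner_zero_left]
  exact Submodule.mem_orthogonal_singleton_iff_inner_right.1 (Λ.fockSubspace_le hα y.2)

theorem Subshift.incl_basisVec {α : List (Fin d)} (hα : α ∈ Λ.admissible) :
    Λ.incl (Λ.basisVec α) = e α := by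
  let x : Λ.FockSpace := ⟨e α, Λ.e_mem_fockSubspace hα⟩
  have hx : Λ.incl x = e α := rfl
  rw [Subshift.basisVec, ← hx, Λ.adjoint_incl_incl]

open scoped Classical in
theorem Subshift.inner_basisVec (α β : List (Fin d)) :
    inner ℂ (Λ.basisVec α) (Λ.basisVec β) = if α = β ∧ α ∈ Λ.admissible then 1 else 0 := by
  by_cases hα : α ∈ Λ.admissible
  · by_cases hβ : β ∈ Λ.admissible
    · rw [← Λ.inner_incl, Λ.incl_basisVec hα, Λ.incl_basisVec hβ, inner_e]
      simp [hα]
    · rw [Λ.basisVec_of_notMem hβ, inner_zero_right, if_neg]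
      rintro ⟨rfl, -⟩
      exact hβ hα
  · rw [Λ.basisVec_of_notMem hα, inner_zero_left, if_neg (fun h => hα h.2)]

theorem Subshift.ext_basisVec {x y : Λ.FockSpace}
    (h : ∀ α, inner ℂ (Λ.basisVec α) x = inner ℂ (Λ.basisVec α) y) : x = y := by
  simp only [Λ.inner_basisVec_left] at h
  have h1 : Λ.incl x = Λ.incl y := lp.ext (funext h)
  rw [← Λ.adjoint_incl_incl x, h1, Λ.adjoint_incl_incl]

theorem Subshift.dense_span_basisVec :
    (Submodule.span ℂ (Set.range Λ.basisVec)).topologicalClosure = ⊤ := by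
  rw [Submodule.topologicalClosure_eq_top_iff, Submodule.eq_bot_iff]
  intro y hy
  refine Λ.ext_basisVec fun α => ?_
  rw [inner_zero_right]
  exact (Submodule.mem_orthogonal _ _).1 hy _ (Submodule.subset_span ⟨α, rfl⟩)

theorem Subshift.ext_clm {a b : Λ.FockSpace →L[ℂ] Λ.FockSpace}
    (h : ∀ α, a (Λ.basisVec α) = b (Λ.basisVec α)) : a = b := by
  refine ContinuousLinearMap.ext_on (s := Set.range Λ.basisVec) ?_ ?_
  · rw [Submodule.dense_iff_topologicalClosure_eq_top]
    exact Λ.dense_span_basisVec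
  · rintro _ ⟨α, rfl⟩
    exact h α

theorem Subshift.shiftOp_basisVec (i : Fin d) (α : List (Fin d)) :
    Λ.shiftOp i (Λ.basisVec α) = Λ.basisVec (i :: α) := by
  by_cases hα : α ∈ Λ.admissible
  · simp only [Subshift.shiftOp, ContinuousLinearMap.comp_apply, Λ.incl_basisVec hα, creation_e]
    rfl
  · rw [Λ.basisVec_of_notMem hα, map_zero,
      Λ.basisVec_of_notMem fun h => hα (Λ.admissible_of_cons h)]

theorem Subshift.star_shiftOp_basisVec_nil (i : Fin d) :
    star (Λ.shiftOp i) (Λ.basisVec []) = 0 := by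
  refine Λ.ext_basisVec fun β => ?_
  rw [ContinuousLinearMap.star_eq_adjoint, ContinuousLinearMap.adjoint_inner_right,
    Λ.shiftOp_basisVec, Λ.inner_basisVec]
  simp

open scoped Classical in
theorem Subshift.star_shiftOp_basisVec_cons (i j : Fin d) (α : List (Fin d)) :
    star (Λ.shiftOp i) (Λ.basisVec (j :: α)) =
      if i = j ∧ i :: α ∈ Λ.admissible then Λ.basisVec α else 0 := by
  refine Λ.ext_basisVec fun β => ?_
  rw [ContinuousLinearMap.star_eq_adjoint, ContinuousLinearMap.adjoint_inner_right,
    Λ.shiftOp_basisVec, Λ.inner_basisVec]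
  by_cases h : i = j ∧ i :: α ∈ Λ.admissible
  · obtain ⟨rfl, h⟩ := h
    have hα := Λ.admissible_of_cons h
    rw [if_pos (show i = i ∧ i :: α ∈ Λ.admissible from ⟨rfl, h⟩), Λ.inner_basisVec]
    by_cases hβ : β = α
    · subst hβ
      rw [if_pos ⟨rfl, h⟩, if_pos ⟨rfl, hα⟩]
    · simp [hβ]
  · rw [if_neg h, inner_zero_right, if_neg]
    rintro ⟨h1, h2⟩
    rw [List.cons.injEq] at h1
    obtain ⟨rfl, rfl⟩ := h1
    exact h ⟨rfl, h2⟩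

theorem Subshift.wordProd_shiftOp_basisVec (α β : List (Fin d)) :
    wordProd Λ.shiftOp α (Λ.basisVec β) = Λ.basisVec (α ++ β) := by
  induction α with
  | nil => simp
  | cons i α ih => simp [ih, Λ.shiftOp_basisVec]

theorem Subshift.wordProd_shiftOp_of_notMem {α : List (Fin d)} (hα : α ∉ Λ.admissible) :
    wordProd Λ.shiftOp α = 0 := by
  refine Λ.ext_clm fun β => ?_
  rw [Λ.wordProd_shiftOp_basisVec, Λ.basisVec_of_notMem fun h => hα (Λ.admissible_of_append h).1]
  rfl

open scoped Classical in
/-- `S^α S^α*` is the orthogonal projection to the span of the basis vectors whose word starts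
with `α`. -/
theorem Subshift.wordProd_mul_star_basisVec (α β : List (Fin d)) :
    (wordProd Λ.shiftOp α * star (wordProd Λ.shiftOp α)) (Λ.basisVec β) =
      if α <+: β then Λ.basisVec β else 0 := by
  by_cases hβ : β ∈ Λ.admissible
  swap
  · simp [Λ.basisVec_of_notMem hβ]
  induction α generalizing β with
  | nil => simp
  | cons i α ih =>
    have h : wordProd Λ.shiftOp (i :: α) * star (wordProd Λ.shiftOp (i :: α)) =
        Λ.shiftOp i * (wordProd Λ.shiftOp α * star (wordProd Λ.shiftOp α)) *
          star (Λ.shiftOp i) := by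
      simp [mul_assoc]
    rw [h, mul_apply_eq_comp, mul_apply_eq_comp]
    cases β with
    | nil => simp [Λ.star_shiftOp_basisVec_nil]
    | cons j β =>
      rw [Λ.star_shiftOp_basisVec_cons]
      by_cases hij : i = j
      · subst hij
        rw [if_pos ⟨rfl, hβ⟩, ih β (Λ.admissible_of_cons hβ)]
        by_cases hp : α <+: β
        · rw [if_pos hp, if_pos ((List.prefix_cons_inj i).2 hp), Λ.shiftOp_basisVec]
        · rw [if_neg hp, map_zero, if_neg (fun h => hp ((List.prefix_cons_inj i).1 h))]
      · rw [if_neg (fun h => hij h.1), map_zero, map_zero, if_neg]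
        rintro ⟨t, ht⟩
        exact hij (List.cons.inj ht).1

theorem isCompactOperator_rankOne {F : Type*} [NormedAddCommGroup F] [InnerProductSpace ℂ F]
    (u v : F) : IsCompactOperator (InnerProductSpace.rankOne ℂ u v) :=
  ((isCompactOperator_id (E := ℂ)).comp_clm (innerSL ℂ v)).clm_comp
    (ContinuousLinearMap.toSpanSingleton ℂ u)

/-- An operator that kills all but finitely many basis vectors has finite rank. -/
theorem Subshift.isCompactOperator_of_basisVec {a : Λ.FockSpace →L[ℂ] Λ.FockSpace} {k : ℕ}
    (h : ∀ α : List (Fin d), k ≤ α.length → a (Λ.basisVec α) = 0) : IsCompactOperator a := by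
  classical
  have key : a = ∑ n ∈ Finset.range k, ∑ α ∈ allWords d n,
      InnerProductSpace.rankOne ℂ (a (Λ.basisVec α)) (Λ.basisVec α) := by
    refine Λ.ext_clm fun β => ?_
    simp only [sum_apply, InnerProductSpace.rankOne_apply, Λ.inner_basisVec]
    by_cases hβ : β ∈ Λ.admissible
    swap
    · rw [Λ.basisVec_of_notMem hβ, map_zero]
      refine (Finset.sum_eq_zero fun n _ => Finset.sum_eq_zero fun α _ => ?_).symm
      rw [if_neg, zero_smul]
      rintro ⟨rfl, h⟩
      exact hβ h
    by_cases hk : β.length < k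
    · rw [Finset.sum_eq_single_of_mem β.length (by simpa using hk),
        Finset.sum_eq_single_of_mem β (by simp)]
      · simp [hβ]
      · intro α _ hα
        simp [hα]
      · intro n _ hn
        refine Finset.sum_eq_zero fun α hα => ?_
        rw [if_neg, zero_smul]
        rintro ⟨rfl, -⟩
        exact hn (mem_allWords.1 hα).symm
    · rw [h β (by omega)]
      refine (Finset.sum_eq_zero fun n hn => Finset.sum_eq_zero fun α hα => ?_).symm
      rw [if_neg, zero_smul]
      rintro ⟨rfl, -⟩
      have := mem_allWords.1 hα
      have := Finset.mem_range.1 hn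
      omega
  rw [key]
  exact Submodule.sum_mem (compactOperator _ _ _) fun n _ =>
    Submodule.sum_mem (compactOperator _ _ _) fun α _ => isCompactOperator_rankOne _ _

end FockBasis

/-! ### Asymptotic intertwining -/

section Intertwining

open Filter Topology TensorProduct

variable {F H : Type*} [NormedAddCommGroup F] [InnerProductSpace ℂ F]
  [NormedAddCommGroup H] [InnerProductSpace ℂ H]

/-- The isometries `K N : H → F ⊗ H` (the algebraic tensor product with its Hilbert space inner
product) intertwine `T` and `a ⊗ 1` in the limit: `(a ⊗ 1) (K N) - (K N) T → 0` strongly. -/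
def AsympIntertwines (K : ℕ → H →ₗᵢ[ℂ] F ⊗[ℂ] H) (a : F →L[ℂ] F) (T : H →L[ℂ] H) : Prop :=
  ∀ h, Tendsto (fun N => a.rTensor H (K N h) - K N (T h)) atTop (𝓝 0)

namespace AsympIntertwines

variable {K : ℕ → H →ₗᵢ[ℂ] F ⊗[ℂ] H} {a b : F →L[ℂ] F} {T S : H →L[ℂ] H}

theorem zero : AsympIntertwines K 0 0 := fun h => by simp

theorem one : AsympIntertwines K 1 1 := fun h => by simp

theorem add (ha : AsympIntertwines K a T) (hb : AsympIntertwines K b S) :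
    AsympIntertwines K (a + b) (T + S) := fun h => by
  simpa [add_sub_add_comm] using! (ha h).add (hb h)

theorem smul (c : ℂ) (ha : AsympIntertwines K a T) : AsympIntertwines K (c • a) (c • T) :=
  fun h => by simpa [smul_sub] using! (ha h).const_smul c

theorem sub (ha : AsympIntertwines K a T) (hb : AsympIntertwines K b S) :
    AsympIntertwines K (a - b) (T - S) := by
  simpa [sub_eq_add_neg] using! ha.add (hb.smul (-1))

theorem mul (ha : AsympIntertwines K a T) (hb : AsympIntertwines K b S) :
    AsympIntertwines K (a * b) (T * S) := fun h => by
  have h1 := ((a.rTensor H).continuous.tendsto 0).comp (hb h)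
  have h2 := h1.add (ha (S h))
  simpa [Function.comp_def, ContinuousLinearMap.rTensor_mul] using! h2

theorem norm_apply_le (ha : AsympIntertwines K a T) (h : H) : ‖T h‖ ≤ ‖a‖ * ‖h‖ := by
  have h1 : Tendsto (fun N => ‖a‖ * ‖h‖ + ‖a.rTensor H (K N h) - K N (T h)‖) atTop
      (𝓝 (‖a‖ * ‖h‖ + 0)) := (tendsto_zero_iff_norm_tendsto_zero.1 (ha h)).const_add _
  rw [add_zero] at h1
  refine ge_of_tendsto' h1 fun N => ?_
  have h2 : ‖a.rTensor H (K N h)‖ ≤ ‖a‖ * ‖h‖ := by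
    refine (ContinuousLinearMap.le_opNorm _ _).trans ?_
    rw [(K N).norm_map]
    gcongr
    exact ContinuousLinearMap.norm_rTensor_le H a
  rw [← (K N).norm_map (T h)]
  have h3 := norm_sub_norm_le (K N (T h)) (a.rTensor H (K N h))
  rw [norm_sub_rev] at h3
  linarith

theorem norm_le (ha : AsympIntertwines K a T) : ‖T‖ ≤ ‖a‖ :=
  T.opNorm_le_bound (norm_nonneg _) ha.norm_apply_le

theorem eq_zero (ha : AsympIntertwines K 0 T) : T = 0 := by
  simpa using ha.norm_le

end AsympIntertwines

theorem isClosed_asympIntertwines (K : ℕ → H →ₗᵢ[ℂ] F ⊗[ℂ] H) :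
    IsClosed {p : (F →L[ℂ] F) × (H →L[ℂ] H) | AsympIntertwines K p.1 p.2} := by
  refine isClosed_of_closure_subset fun p hp h => ?_
  rw [Metric.mem_closure_iff] at hp
  rw [Metric.tendsto_atTop]
  intro ε hε
  have hδ : 0 < ε / (3 * (‖h‖ + 1)) := by positivity
  set δ := ε / (3 * (‖h‖ + 1)) with hδ_def
  have hδh : δ * ‖h‖ < ε / 3 := by
    rw [hδ_def, div_mul_eq_mul_div, div_lt_div_iff₀ (by positivity) (by norm_num)]
    nlinarith [norm_nonneg h]
  obtain ⟨q, hq, hpq⟩ := hp δ hδ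
  obtain ⟨N₀, hN₀⟩ := Metric.tendsto_atTop.1 (hq h) (ε / 3) (by positivity)
  refine ⟨N₀, fun N hN => ?_⟩
  have h1 := hN₀ N hN
  rw [dist_zero_right] at h1 ⊢
  rw [Prod.dist_eq, max_lt_iff, dist_eq_norm, dist_eq_norm] at hpq
  have h2 : ‖(p.1 - q.1).rTensor H (K N h)‖ ≤ δ * ‖h‖ := by
    refine (ContinuousLinearMap.le_opNorm _ _).trans ?_
    rw [(K N).norm_map]
    gcongr
    exact (ContinuousLinearMap.norm_rTensor_le H _).trans hpq.1.le
  have h3 : ‖K N ((p.2 - q.2) h)‖ ≤ δ * ‖h‖ := by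
    rw [(K N).norm_map]
    refine (ContinuousLinearMap.le_opNorm _ _).trans ?_
    gcongr
    exact hpq.2.le
  have h4 : p.1.rTensor H (K N h) - K N (p.2 h) = (p.1 - q.1).rTensor H (K N h) +
      (q.1.rTensor H (K N h) - K N (q.2 h)) - K N ((p.2 - q.2) h) := by
    simp only [ContinuousLinearMap.rTensor_sub, sub_apply, map_sub]
    abel
  rw [h4]
  have h5 := norm_sub_le ((p.1 - q.1).rTensor H (K N h) +
      (q.1.rTensor H (K N h) - K N (q.2 h))) (K N ((p.2 - q.2) h))
  have h6 := norm_add_le ((p.1 - q.1).rTensor H (K N h)) (q.1.rTensor H (K N h) - K N (q.2 h))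
  linarith

section Hilbert

variable [CompleteSpace F]

/-- A compact operator is a norm limit of operators of finite rank: it is almost unchanged by the
projection to the span of a finite `ε`-net in the image of the unit ball. -/
theorem exists_norm_sub_sum_rankOne_le {a : F →L[ℂ] F} (ha : IsCompactOperator a) {ε : ℝ}
    (hε : 0 < ε) : ∃ (n : ℕ) (u v : Fin n → F),
      ‖a - ∑ j, InnerProductSpace.rankOne ℂ (u j) (v j)‖ ≤ ε := by
  obtain ⟨t, htf, hcov⟩ := Metric.totallyBounded_iff.1
    ((ha.isCompact_closure_image_closedBall 1).totallyBounded.subset subset_closure) ε hε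
  let U := Submodule.span ℂ t
  have : FiniteDimensional ℂ U := FiniteDimensional.span_of_finite ℂ htf
  let B := stdOrthonormalBasis ℂ U
  refine ⟨_, fun j => (B j : F), fun j => a.adjoint (B j), ?_⟩
  have hP : ∑ j, InnerProductSpace.rankOne ℂ (B j : F) (a.adjoint (B j)) =
      U.starProjection ∘L a := by
    ext x
    rw [B.starProjection_eq_sum_rankOne]
    simp [sum_apply, ContinuousLinearMap.adjoint_inner_left]
  rw [hP]
  refine ContinuousLinearMap.opNorm_le_of_unit_norm hε.le fun x hx => ?_
  obtain ⟨y, hy, hxy⟩ := Set.mem_iUnion₂.1 (hcov ⟨x, by simp [hx], rfl⟩)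
  rw [Metric.mem_ball, dist_eq_norm] at hxy
  calc ‖a x - U.starProjection (a x)‖ = ⨅ z : U, ‖a x - z‖ := U.starProjection_minimal (a x)
    _ ≤ ‖a x - y‖ :=
      ciInf_le (f := fun z : U => ‖a x - z‖) ⟨0, Set.forall_mem_range.2 fun _ => norm_nonneg _⟩
        ⟨y, Submodule.subset_span hy⟩
    _ ≤ ε := hxy.le

/-- Compact operators are asymptotically intertwined with `0` as soon as this holds for the rank
one operators that test against a total family. -/
theorem asympIntertwines_zero_of_isCompactOperator {K : ℕ → H →ₗᵢ[ℂ] F ⊗[ℂ] H} {ι : Type*}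
    {f : ι → F} (hf : (Submodule.span ℂ (Set.range f)).topologicalClosure = ⊤)
    (h : ∀ u i, AsympIntertwines K (InnerProductSpace.rankOne ℂ u (f i)) 0)
    {a : F →L[ℂ] F} (ha : IsCompactOperator a) : AsympIntertwines K a 0 := by
  have hcl : IsClosed {a : F →L[ℂ] F | AsympIntertwines K a 0} :=
    (isClosed_asympIntertwines K).preimage (Continuous.prodMk_left (0 : H →L[ℂ] H))
  have h1 : ∀ u v, AsympIntertwines K (InnerProductSpace.rankOne ℂ u v) 0 := by
    intro u
    let U : Submodule ℂ F :=
      { carrier := {v | AsympIntertwines K (InnerProductSpace.rankOne ℂ u v) 0}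
        add_mem' := fun {v w} hv hw => by simpa using! hv.add hw
        zero_mem' := by simpa using! AsympIntertwines.zero
        smul_mem' := fun c v hv => by simpa using! hv.smul (star c) }
    have hU : IsClosed (U : Set F) :=
      hcl.preimage (InnerProductSpace.rankOne ℂ u).continuous
    have hle : (Submodule.span ℂ (Set.range f)).topologicalClosure ≤ U := by
      refine Submodule.topologicalClosure_minimal _ (Submodule.span_le.2 ?_) hU
      rintro _ ⟨i, rfl⟩
      exact h u i
    rw [hf] at hle
    exact fun v => hle Submodule.mem_top
  have hmem : a ∈ closure {a : F →L[ℂ] F | AsympIntertwines K a 0} := by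
    refine Metric.mem_closure_iff.2 fun ε hε => ?_
    obtain ⟨n, u, v, huv⟩ := exists_norm_sub_sum_rankOne_le ha (half_pos hε)
    refine ⟨_, ?_, (dist_eq_norm a _).trans_lt (huv.trans_lt (half_lt_self hε))⟩
    refine Finset.sum_induction _ (fun b => AsympIntertwines K b (0 : H →L[ℂ] H))
      (fun b c hb hc => by simpa using! hb.add hc) .zero fun j _ => h1 _ _
  rwa [hcl.closure_eq] at hmem

variable [CompleteSpace H]

/-- The pairs `(a, T)` for which both `(a, T)` and `(a*, T*)` are asymptotically intertwined. -/
def intertwinedPairs (K : ℕ → H →ₗᵢ[ℂ] F ⊗[ℂ] H) :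
    StarSubalgebra ℂ ((F →L[ℂ] F) × (H →L[ℂ] H)) where
  carrier := {p | AsympIntertwines K p.1 p.2 ∧ AsympIntertwines K (star p.1) (star p.2)}
  mul_mem' {p q} hp hq := by
    refine ⟨hp.1.mul hq.1, ?_⟩
    rw [Prod.fst_mul, Prod.snd_mul, star_mul, star_mul]
    exact hq.2.mul hp.2
  add_mem' {p q} hp hq := by
    refine ⟨hp.1.add hq.1, ?_⟩
    rw [Prod.fst_add, Prod.snd_add, star_add, star_add]
    exact hp.2.add hq.2
  algebraMap_mem' c := by
    rw [Algebra.algebraMap_eq_smul_one]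
    refine ⟨AsympIntertwines.one.smul c, ?_⟩
    rw [Prod.smul_fst, Prod.smul_snd, Prod.fst_one, Prod.snd_one, star_smul, star_smul, star_one,
      star_one]
    exact AsympIntertwines.one.smul (star c)
  star_mem' {p} hp := by
    refine ⟨hp.2, ?_⟩
    rw [Prod.fst_star, Prod.snd_star, star_star, star_star]
    exact hp.1

theorem isClosed_intertwinedPairs (K : ℕ → H →ₗᵢ[ℂ] F ⊗[ℂ] H) :
    IsClosed (intertwinedPairs K : Set ((F →L[ℂ] F) × (H →L[ℂ] H))) :=
  (isClosed_asympIntertwines K).inter ((isClosed_asympIntertwines K).preimage continuous_star)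

/-- The first projection of the algebra of intertwined pairs. It is isometric because `‖T‖ ≤ ‖a‖`
for an intertwined pair `(a, T)`. -/
def intertwinedFst (K : ℕ → H →ₗᵢ[ℂ] F ⊗[ℂ] H) : intertwinedPairs K →⋆ₐ[ℂ] (F →L[ℂ] F) :=
  (StarAlgHom.fst ℂ (F →L[ℂ] F) (H →L[ℂ] H)).comp (intertwinedPairs K).subtype

theorem isometry_intertwinedFst (K : ℕ → H →ₗᵢ[ℂ] F ⊗[ℂ] H) : Isometry (intertwinedFst K) := by
  refine AddMonoidHomClass.isometry_of_norm _ fun p => ?_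
  exact (max_eq_left p.2.1.norm_le).symm

theorem isClosed_range_intertwinedFst (K : ℕ → H →ₗᵢ[ℂ] F ⊗[ℂ] H) :
    IsClosed ((intertwinedFst K).range : Set (F →L[ℂ] F)) := by
  have : CompleteSpace (intertwinedPairs K) :=
    (isClosed_intertwinedPairs K).completeSpace_coe
  exact (isometry_intertwinedFst K).isClosedEmbedding.isClosed_range

/-- A family `(s, t)` of intertwined pairs extends to a representation of the C⋆-algebra generated
by `s`. -/
theorem exists_hom_of_asympIntertwines (K : ℕ → H →ₗᵢ[ℂ] F ⊗[ℂ] H) {ι : Type*}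
    (s : ι → F →L[ℂ] F) (t : ι → H →L[ℂ] H) (h : ∀ i, AsympIntertwines K (s i) (t i))
    (h' : ∀ i, AsympIntertwines K (star (s i)) (star (t i))) :
    ∃ ρ : (StarAlgebra.adjoin ℂ (Set.range s)).topologicalClosure →⋆ₐ[ℂ] (H →L[ℂ] H),
      ∀ a, AsympIntertwines K a.1 (ρ a) := by
  have hle : (StarAlgebra.adjoin ℂ (Set.range s)).topologicalClosure ≤
      (intertwinedFst K).range := by
    refine StarSubalgebra.topologicalClosure_minimal (StarAlgebra.adjoin_le ?_)
      (isClosed_range_intertwinedFst K)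
    rintro _ ⟨i, rfl⟩
    exact ⟨⟨(s i, t i), h i, h' i⟩, rfl⟩
  let e := StarAlgEquiv.ofInjective (intertwinedFst K) (isometry_intertwinedFst K).injective
  let ρ : (StarAlgebra.adjoin ℂ (Set.range s)).topologicalClosure →⋆ₐ[ℂ] (H →L[ℂ] H) :=
    ((StarAlgHom.snd ℂ (F →L[ℂ] F) (H →L[ℂ] H)).comp (intertwinedPairs K).subtype).comp
      ((e.symm : (intertwinedFst K).range →⋆ₐ[ℂ] intertwinedPairs K).comp
        (StarSubalgebra.inclusion hle))
  refine ⟨ρ, fun a => ?_⟩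
  have h1 : intertwinedFst K (e.symm (StarSubalgebra.inclusion hle a)) = a.1 :=
    congrArg Subtype.val (e.apply_symm_apply (StarSubalgebra.inclusion hle a))
  have h2 := (e.symm (StarSubalgebra.inclusion hle a)).2.1
  rw [← h1]
  exact h2

end Hilbert

end Intertwining

/-! ### Consequences of the relations -/

section Evaluation

variable {d : ℕ}

theorem basisFreeMonoid_apply (α : List (Fin d)) :
    FreeAlgebra.basisFreeMonoid ℂ (Fin d) (FreeMonoid.ofList α) =
      wordProd (FreeAlgebra.ι ℂ) α := by
  have h : FreeAlgebra.basisFreeMonoid ℂ (Fin d) (FreeMonoid.ofList α) =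
      FreeAlgebra.equivMonoidAlgebraFreeMonoid.symm
        (MonoidAlgebra.single (FreeMonoid.ofList α) (1 : ℂ)) := by
    simp only [FreeAlgebra.basisFreeMonoid, Module.Basis.map_apply, Finsupp.coe_basisSingleOne]
    rfl
  rw [h]
  change MonoidAlgebra.lift ℂ _ _ (FreeMonoid.lift (FreeAlgebra.ι ℂ))
    (MonoidAlgebra.single (FreeMonoid.ofList α) (1 : ℂ)) = _
  simp [MonoidAlgebra.lift_single, FreeMonoid.lift_apply, wordProd]

theorem evalBasis_wordProd (α : List (Fin d)) :
    evalBasis d (wordProd (FreeAlgebra.ι ℂ) α) = e α := by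
  rw [← basisFreeMonoid_apply, evalBasis, Module.Basis.constr_basis]
  rfl

theorem lift_wordProd {A : Type*} [Ring A] [Algebra ℂ A] (T : Fin d → A) (α : List (Fin d)) :
    FreeAlgebra.lift ℂ T (wordProd (FreeAlgebra.ι ℂ) α) = wordProd T α := by
  rw [map_wordProd]
  simp

/-- The coefficients of `p` can be read off from `p(e)`. -/
theorem repr_eq_evalBasis (p : FreeAlgebra ℂ (Fin d)) (α : FreeMonoid (Fin d)) :
    (FreeAlgebra.basisFreeMonoid ℂ (Fin d)).repr p α = (evalBasis d p : Fock d) α.toList := by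
  classical
  let φ : FreeAlgebra ℂ (Fin d) →ₗ[ℂ] ℂ :=
    (innerSL ℂ (e α.toList : Fock d)).toLinearMap ∘ₗ evalBasis d
  have hφ : ∀ q, φ q = (evalBasis d q : Fock d) α.toList := fun q => by
    simp [φ, e, lp.inner_single_left]
  rw [← hφ, ← Module.Basis.coord_apply]
  congr 1
  refine (FreeAlgebra.basisFreeMonoid ℂ (Fin d)).ext fun β => ?_
  simp only [φ, evalBasis, LinearMap.comp_apply, Module.Basis.constr_basis,
    Module.Basis.coord_apply, Module.Basis.repr_self, ContinuousLinearMap.coe_coe,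
    innerSL_apply_apply, inner_e, Finsupp.single_apply]
  simp [eq_comm]

/-- The first relation only concerns monomials: `T^α = 0` for every nonempty word outside the
language suffices. -/
theorem Subshift.lift_eq_zero_of_mem_polyIdeal (Λ : Subshift d) {A : Type*} [Ring A] [Algebra ℂ A]
    {T : Fin d → A} (hT : ∀ α ∉ Λ.admissible, wordProd T α = 0) {p : FreeAlgebra ℂ (Fin d)}
    (hp : p ∈ Λ.polyIdeal) : FreeAlgebra.lift ℂ T p = 0 := by
  classical
  refine Submodule.span_le (p := LinearMap.ker (FreeAlgebra.lift ℂ T).toLinearMap) |>.2 ?_ hp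
  rintro p ⟨n, hn, hp1, hp2⟩
  rw [SetLike.mem_coe, LinearMap.mem_ker,
    ← (FreeAlgebra.basisFreeMonoid ℂ (Fin d)).linearCombination_repr p,
    Finsupp.linearCombination_apply, Finsupp.sum, map_sum]
  refine Finset.sum_eq_zero fun α _ => ?_
  have hα : FreeAlgebra.basisFreeMonoid ℂ (Fin d) α = wordProd (FreeAlgebra.ι ℂ) α.toList :=
    basisFreeMonoid_apply α.toList
  rw [hα, map_smul, AlgHom.toLinearMap_apply, lift_wordProd, repr_eq_evalBasis]
  by_cases h : α.toList ∈ Λ.admissible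
  swap
  · rw [hT _ h, smul_zero]
  suffices h0 : inner ℂ (e α.toList : Fock d) (evalBasis d p) = 0 by
    have h1 : (evalBasis d p : Fock d) α.toList = 0 := by
      simpa [e, lp.inner_single_left] using h0
    rw [h1, zero_smul]
  by_cases hl : α.toList.length = n
  · -- here `e_α` lies in `X(n)`, to which `p(e)` is orthogonal
    refine (Submodule.mem_orthogonal _ _).1 hp2 _ ?_
    rw [Subshift.fibre, if_neg hn.ne']
    refine Submodule.subset_span ⟨_, Λ.mem_words.2 ⟨hl, h.resolve_left fun h0 => ?_⟩, rfl⟩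
    rw [h0] at hl
    exact hn.ne hl
  · -- here `e_α` is orthogonal to `E^{⊗n}`, which contains `p(e)`
    have hle : tensorPower d n ≤ (Submodule.span ℂ {(e α.toList : Fock d)})ᗮ := by
      refine Submodule.span_le.2 ?_
      rintro _ ⟨β, hβ, rfl⟩
      rw [SetLike.mem_coe, Submodule.mem_orthogonal_singleton_iff_inner_right, inner_e, if_neg]
      intro h1
      exact hl (h1 ▸ hβ)
    exact Submodule.mem_orthogonal_singleton_iff_inner_right.1 (hle hp1)

theorem wordProd_mem_polyIdeal {Λ : Subshift d} {α : List (Fin d)} (hα : α ∉ Λ.admissible) :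
    wordProd (FreeAlgebra.ι ℂ) α ∈ Λ.polyIdeal := by
  classical
  have hne : α.length ≠ 0 := fun h => hα (Or.inl (List.length_eq_zero_iff.1 h))
  refine Submodule.subset_span ⟨α.length, Nat.pos_of_ne_zero hne, ?_⟩
  rw [evalBasis_wordProd]
  refine ⟨Submodule.subset_span ⟨α, rfl, rfl⟩, ?_⟩
  rw [Subshift.fibre, if_neg hne]
  have hle : Submodule.span ℂ ((e : List (Fin d) → Fock d) '' Λ.words α.length) ≤
      (Submodule.span ℂ {(e α : Fock d)})ᗮ := by
    refine Submodule.span_le.2 ?_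
    rintro _ ⟨β, hβ, rfl⟩
    rw [SetLike.mem_coe, Submodule.mem_orthogonal_singleton_iff_inner_right, inner_e, if_neg]
    rintro rfl
    exact hα (Or.inr (Λ.mem_words.1 hβ).2)
  exact Submodule.orthogonal_le hle
    (Submodule.le_orthogonal_orthogonal _ (Submodule.mem_span_singleton_self _))

end Evaluation

section PositiveSums

variable {H : Type*} [NormedAddCommGroup H] [InnerProductSpace ℂ H] [CompleteSpace H]

theorem norm_star_apply_sq (a : H →L[ℂ] H) (h : H) :
    ((‖star a h‖ ^ 2 : ℝ) : ℂ) = inner ℂ h ((a * star a) h) := by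
  rw [mul_apply_eq_comp, ContinuousLinearMap.star_eq_adjoint,
    ← ContinuousLinearMap.adjoint_inner_left, inner_self_eq_norm_sq_to_K]
  simp

theorem eq_zero_of_sum_mul_star_eq_zero {ι : Type*} {s : Finset ι} {a : ι → H →L[ℂ] H}
    (h : ∑ i ∈ s, a i * star (a i) = 0) {i : ι} (hi : i ∈ s) : a i = 0 := by
  rw [← star_eq_zero]
  ext x
  have h1 : ∑ i ∈ s, ‖star (a i) x‖ ^ 2 = 0 := by
    have h2 : ((∑ i ∈ s, ‖star (a i) x‖ ^ 2 : ℝ) : ℂ) = 0 := by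
      rw [Complex.ofReal_sum, Finset.sum_congr rfl fun i _ => norm_star_apply_sq (a i) x,
        ← inner_sum, ← sum_apply, h]
      simp
    exact_mod_cast h2
  have h3 := (Finset.sum_eq_zero_iff_of_nonneg fun i _ => by positivity).1 h1 i hi
  simpa using h3

/-- If a self-adjoint `p` satisfies `p (1 - p) = 0`, where `p` is the sum of `x x*` over a subset
of a family with `∑ x x* = 1`, then `p x = x` on the subset and `p x = 0` off it: both
`p (1 - p) p` and `(1 - p) p (1 - p)` are vanishing sums of positive operators. -/
theorem projection_mul_eq {ι : Type*} [DecidableEq ι] {s t : Finset ι} (hst : s ⊆ t)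
    {x : ι → H →L[ℂ] H} {p : H →L[ℂ] H} (hp : p * p = p) (hp' : star p = p)
    (hs : p = ∑ i ∈ s, x i * star (x i)) (ht : ∑ i ∈ t, x i * star (x i) = 1) {i : ι}
    (hi : i ∈ t) : p * x i = if i ∈ s then x i else 0 := by
  have conj : ∀ (u : Finset ι) (q : H →L[ℂ] H), star q = q →
      ∑ i ∈ u, (q * x i) * star (q * x i) = q * (∑ i ∈ u, x i * star (x i)) * q := by
    intro u q hq
    simp [Finset.mul_sum, Finset.sum_mul, mul_assoc, hq]
  split_ifs with his
  · have h1 : ∑ i ∈ s, ((1 - p) * x i) * star ((1 - p) * x i) = 0 := by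
      rw [conj s (1 - p) (by simp [hp']), ← hs]
      simp [sub_mul, mul_sub, hp]
    have h2 := eq_zero_of_sum_mul_star_eq_zero h1 his
    rw [sub_mul, one_mul, sub_eq_zero] at h2
    exact h2.symm
  · have h3 : ∑ i ∈ t \ s, x i * star (x i) = 1 - p := by
      rw [← ht, hs, eq_sub_iff_add_eq, Finset.sum_sdiff hst]
    have h1 : ∑ i ∈ t \ s, (p * x i) * star (p * x i) = 0 := by
      rw [conj _ p hp', h3]
      simp [mul_sub, hp]
    exact eq_zero_of_sum_mul_star_eq_zero h1 (Finset.mem_sdiff.2 ⟨hi, his⟩)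

end PositiveSums

namespace Subshift.Relations

variable {d : ℕ} {Λ : Subshift d} {k : ℕ}

section Algebraic

variable {A : Type*} [Ring A] [StarRing A] [Algebra ℂ A] {T : Fin d → A}

theorem wordProd_eq_zero (h : Λ.Relations k T) {α : List (Fin d)} (hα : α ∉ Λ.admissible) :
    wordProd T α = 0 := by
  rw [← lift_wordProd]
  exact h.z1 _ (wordProd_mem_polyIdeal hα)

theorem mul_star_mul_self (h : Λ.Relations k T) (i : Fin d) : T i * (star (T i) * T i) = T i := by
  have h1 : ∑ j, T j * star (T j) * T i = T i := by rw [← Finset.sum_mul, h.z3, one_mul]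
  rw [Finset.sum_eq_single_of_mem i (Finset.mem_univ i)] at h1
  · rwa [mul_assoc] at h1
  · intro j _ hj
    rw [mul_assoc, h.z2 j i hj, mul_zero]

theorem sum_wordProd_mul_star (h : Λ.Relations k T) (n : ℕ) :
    ∑ α ∈ allWords d n, wordProd T α * star (wordProd T α) = 1 := by
  induction n with
  | zero => simp [allWords_zero]
  | succ n ih =>
    rw [sum_allWords_succ, ← h.z3]
    refine Finset.sum_congr rfl fun i _ => ?_
    calc ∑ α ∈ allWords d n, wordProd T (i :: α) * star (wordProd T (i :: α))
        = T i * (∑ α ∈ allWords d n, wordProd T α * star (wordProd T α)) * star (T i) := by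
          simp [Finset.mul_sum, Finset.sum_mul, mul_assoc]
      _ = T i * star (T i) := by rw [ih, mul_one]

end Algebraic

section Operators

variable {H : Type*} [NormedAddCommGroup H] [InnerProductSpace ℂ H] [CompleteSpace H]

open scoped Classical in
/-- For a `k`-step subshift, the initial projection of `T_i` acts on `T^α`, `|α| ≥ k`, in the same
way as that of the shift operator `S_i` acts on `S^α`. -/
theorem star_mul_self_mul_wordProd {T : Fin d → H →L[ℂ] H} (h : Λ.Relations k T)
    (hΛ : Λ.IsStepSFT k) (i : Fin d) {α : List (Fin d)} (hα : k ≤ α.length) :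
    star (T i) * T i * wordProd T α = if i :: α ∈ Λ.admissible then wordProd T α else 0 := by
  by_cases hadm : α ∈ Λ.admissible
  swap
  · simp [h.wordProd_eq_zero hadm]
  have key : star (T i) * T i * wordProd T (α.take k) =
      if α.take k ∈ (Λ.finite_followers i k).toFinset then wordProd T (α.take k) else 0 := by
    refine projection_mul_eq (t := allWords d k) (x := wordProd T) ?_ ?_ ?_ (h.z4 i)
      (h.sum_wordProd_mul_star k) (by simpa using hα)
    · intro β hβ
      rw [Set.Finite.mem_toFinset] at hβ
      exact mem_allWords.2 hβ.1.1
    · rw [mul_assoc, h.mul_star_mul_self]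
    · simp
  simp only [Set.Finite.mem_toFinset, hΛ.take_mem_followers hadm hα] at key
  nth_rw 1 [← List.take_append_drop k α]
  rw [wordProd_append, ← mul_assoc, key]
  split_ifs
  · rw [← wordProd_append, List.take_append_drop]
  · rw [zero_mul]

end Operators

end Subshift.Relations

/-! ### The asymptotic Poisson kernel of a tuple satisfying the relations -/

section Poisson

open Filter Topology TensorProduct

variable {d : ℕ} (Λ : Subshift d) {H : Type*} [NormedAddCommGroup H] [InnerProductSpace ℂ H]
  [CompleteSpace H] (T : Fin d → H →L[ℂ] H)

/-- The degree `n` part `h ↦ ∑_{|α| = n} e_α ⊗ T^α* h` of the Poisson kernel of `T`. -/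
def poissonPart (n : ℕ) : H →ₗ[ℂ] Λ.FockSpace ⊗[ℂ] H :=
  ∑ α ∈ allWords d n,
    TensorProduct.mk ℂ Λ.FockSpace H (Λ.basisVec α) ∘ₗ (star (wordProd T α)).toLinearMap

theorem poissonPart_apply (n : ℕ) (h : H) :
    poissonPart Λ T n h = ∑ α ∈ allWords d n, Λ.basisVec α ⊗ₜ[ℂ] star (wordProd T α) h := by
  simp [poissonPart]

theorem poissonPart_zero (h : H) : poissonPart Λ T 0 h = Λ.basisVec [] ⊗ₜ[ℂ] h := by
  simp [poissonPart_apply, allWords_zero]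

theorem poissonPart_succ (n : ℕ) (h : H) :
    poissonPart Λ T (n + 1) h = ∑ i, ∑ α ∈ allWords d n,
      Λ.basisVec (i :: α) ⊗ₜ[ℂ] star (wordProd T α) (star (T i) h) := by
  rw [poissonPart_apply, sum_allWords_succ]
  simp [star_mul]

variable {Λ T} {k : ℕ}

theorem inner_poissonPart (hT : Λ.Relations k T) (n m : ℕ) (g h : H) :
    inner ℂ (poissonPart Λ T n g) (poissonPart Λ T m h) = if n = m then inner ℂ g h else 0 := by
  classical
  simp only [poissonPart_apply, sum_inner, inner_sum, TensorProduct.inner_tmul, Λ.inner_basisVec]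
  split_ifs with hnm
  · subst hnm
    rw [Finset.sum_comm]
    calc ∑ β ∈ allWords d n, ∑ α ∈ allWords d n,
          (if β = α ∧ β ∈ Λ.admissible then (1 : ℂ) else 0) *
            inner ℂ (star (wordProd T β) g) (star (wordProd T α) h)
        = ∑ β ∈ allWords d n, inner ℂ g ((wordProd T β * star (wordProd T β)) h) := by
          refine Finset.sum_congr rfl fun β hβ => ?_
          rw [Finset.sum_eq_single_of_mem β hβ]
          · by_cases hadm : β ∈ Λ.admissible
            · rw [if_pos ⟨rfl, hadm⟩, one_mul, mul_apply_eq_comp,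
                ContinuousLinearMap.star_eq_adjoint, ContinuousLinearMap.adjoint_inner_left]
            · simp [hT.wordProd_eq_zero hadm]
          · intro α _ hα
            rw [if_neg (fun h => hα h.1.symm), zero_mul]
      _ = inner ℂ g h := by
          rw [← inner_sum, ← sum_apply, hT.sum_wordProd_mul_star]
          rfl
  · refine Finset.sum_eq_zero fun α hα => Finset.sum_eq_zero fun β hβ => ?_
    rw [if_neg, zero_mul]
    rintro ⟨rfl, -⟩
    exact hnm ((mem_allWords.1 hβ).symm.trans (mem_allWords.1 hα))

theorem norm_poissonPart (hT : Λ.Relations k T) (n : ℕ) (h : H) :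
    ‖poissonPart Λ T n h‖ = ‖h‖ :=
  ((poissonPart Λ T n).isometryOfInner fun g h => by
    rw [inner_poissonPart hT, if_pos rfl]).norm_map h

/-- From degree `k` on, the degree parts of the Poisson kernel intertwine exactly. -/
theorem rTensor_shiftOp_poissonPart (hT : Λ.Relations k T) (hΛ : Λ.IsStepSFT k) (i : Fin d)
    {n : ℕ} (hn : k ≤ n) (h : H) :
    (Λ.shiftOp i).rTensor H (poissonPart Λ T n h) = poissonPart Λ T (n + 1) (T i h) := by
  rw [poissonPart_succ, Finset.sum_eq_single_of_mem i (Finset.mem_univ i), poissonPart_apply,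
    map_sum]
  · refine Finset.sum_congr rfl fun α hα => ?_
    rw [ContinuousLinearMap.rTensor_tmul, Λ.shiftOp_basisVec]
    by_cases hadm : i :: α ∈ Λ.admissible
    · congr 1
      have h1 := hT.star_mul_self_mul_wordProd hΛ i (α := α) (by rw [mem_allWords.1 hα]; exact hn)
      rw [if_pos hadm] at h1
      have h2 := congrArg star h1
      rw [star_mul, star_mul, star_star] at h2
      exact (DFunLike.congr_fun h2 h).symm
    · rw [Λ.basisVec_of_notMem hadm, zero_tmul, zero_tmul]
  · intro j _ hj
    refine Finset.sum_eq_zero fun α _ => ?_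
    rw [← mul_apply_eq_comp (star (T j)), hT.z2 j i hj]
    simp

theorem rTensor_star_shiftOp_poissonPart_zero (i : Fin d) (h : H) :
    (star (Λ.shiftOp i)).rTensor H (poissonPart Λ T 0 h) = 0 := by
  rw [poissonPart_zero, ContinuousLinearMap.rTensor_tmul, Λ.star_shiftOp_basisVec_nil, zero_tmul]

theorem rTensor_star_shiftOp_poissonPart_succ (hT : Λ.Relations k T) (i : Fin d) (n : ℕ) (h : H) :
    (star (Λ.shiftOp i)).rTensor H (poissonPart Λ T (n + 1) h) =
      poissonPart Λ T n (star (T i) h) := by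
  classical
  rw [poissonPart_succ, poissonPart_apply, map_sum,
    Finset.sum_eq_single_of_mem i (Finset.mem_univ i), map_sum]
  · refine Finset.sum_congr rfl fun α _ => ?_
    rw [ContinuousLinearMap.rTensor_tmul, Λ.star_shiftOp_basisVec_cons]
    by_cases hadm : i :: α ∈ Λ.admissible
    · rw [if_pos ⟨rfl, hadm⟩]
    · have h1 : star (wordProd T α) (star (T i) h) = 0 := by
        rw [← mul_apply_eq_comp (star (wordProd T α)), ← star_mul, ← wordProd_cons,
          hT.wordProd_eq_zero hadm, star_zero]
        rfl
      rw [h1, tmul_zero, tmul_zero]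
  · intro j _ hj
    rw [map_sum]
    refine Finset.sum_eq_zero fun α _ => ?_
    rw [ContinuousLinearMap.rTensor_tmul, Λ.star_shiftOp_basisVec_cons,
      if_neg (fun h => hj h.1.symm), zero_tmul]

/-- The normalised average `(N + 1)^{-1/2} ∑_{n ≤ N} ∑_{|α| = n} e_α ⊗ T^α* h` of the parts of the
Poisson kernel. The parts are isometries with orthogonal ranges, so the average is an isometry. -/
def poissonAverage (hT : Λ.Relations k T) (N : ℕ) : H →ₗᵢ[ℂ] Λ.FockSpace ⊗[ℂ] H :=
  LinearMap.isometryOfInner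
    (((√(N + 1 : ℝ))⁻¹ : ℂ) • ∑ n ∈ Finset.range (N + 1), poissonPart Λ T n) fun g h => by
      have h1 : ((√(N + 1 : ℝ) : ℝ) : ℂ) * (√(N + 1 : ℝ) : ℝ) = N + 1 := by
        rw [← Complex.ofReal_mul, Real.mul_self_sqrt (by positivity)]
        simp
      have h2 : ((√(N + 1 : ℝ) : ℝ) : ℂ) ≠ 0 := by
        exact_mod_cast (Real.sqrt_pos.2 (by positivity : (0 : ℝ) < N + 1)).ne'
      simp only [LinearMap.smul_apply, LinearMap.sum_apply, inner_smul_left, inner_smul_right,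
        sum_inner, inner_sum, inner_poissonPart hT, map_inv₀, Complex.conj_ofReal,
        Finset.sum_ite_eq']
      rw [← Finset.mul_sum, Finset.sum_congr rfl fun n hn => if_pos hn, Finset.sum_const,
        Finset.card_range, nsmul_eq_mul, ← mul_assoc, ← mul_assoc, ← mul_inv, h1, Nat.cast_succ,
        inv_mul_cancel₀, one_mul]
      rw [← h1]
      exact mul_ne_zero h2 h2

theorem poissonAverage_apply (hT : Λ.Relations k T) (N : ℕ) (h : H) :
    poissonAverage hT N h =
      ((√(N + 1 : ℝ))⁻¹ : ℂ) • ∑ n ∈ Finset.range (N + 1), poissonPart Λ T n h := by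
  simp [poissonAverage]

theorem tendsto_inv_sqrt_smul_of_norm_le {E : Type*} [NormedAddCommGroup E] [NormedSpace ℂ E]
    {x : ℕ → E} {C : ℝ} (hx : ∀ N, ‖x N‖ ≤ C) :
    Tendsto (fun N : ℕ => ((√(N + 1 : ℝ))⁻¹ : ℂ) • x N) atTop (𝓝 0) := by
  have h1 : Tendsto (fun N : ℕ => (√(N + 1 : ℝ))⁻¹ * C) atTop (𝓝 (0 * C)) :=
    (tendsto_inv_atTop_zero.comp (Real.tendsto_sqrt_atTop.comp
      (tendsto_natCast_atTop_atTop.atTop_add (tendsto_const_nhds (x := (1 : ℝ)))))).mul_const C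
  rw [zero_mul] at h1
  refine squeeze_zero_norm (fun N => ?_) h1
  rw [norm_smul, norm_inv, Complex.norm_real, Real.norm_of_nonneg (Real.sqrt_nonneg _)]
  gcongr
  exact hx N

theorem norm_sum_range_le_of_eventually_zero {E : Type*} [NormedAddCommGroup E] {x : ℕ → E}
    {k : ℕ} (hx : ∀ n, k ≤ n → x n = 0) (N : ℕ) :
    ‖∑ n ∈ Finset.range N, x n‖ ≤ ∑ n ∈ Finset.range k, ‖x n‖ := by
  have h1 : ∑ n ∈ Finset.range N with n < k, x n = ∑ n ∈ Finset.range N, x n :=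
    Finset.sum_filter_of_ne fun n _ hn => by
      by_contra h
      exact hn (hx n (by omega))
  rw [← h1]
  refine (norm_sum_le _ _).trans
    (Finset.sum_le_sum_of_subset_of_nonneg (fun n hn => ?_) fun n _ _ => norm_nonneg _)
  exact Finset.mem_range.2 (Finset.mem_filter.1 hn).2

/-- The averages intertwine asymptotically when the sums of the errors in each degree are
bounded. -/
theorem asympIntertwines_poissonAverage (hT : Λ.Relations k T)
    {a : Λ.FockSpace →L[ℂ] Λ.FockSpace} {S : H →L[ℂ] H} (C : H → ℝ)
    (hC : ∀ h N, ‖∑ n ∈ Finset.range (N + 1),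
      (a.rTensor H (poissonPart Λ T n h) - poissonPart Λ T n (S h))‖ ≤ C h) :
    AsympIntertwines (poissonAverage hT) a S := by
  intro h
  refine (tendsto_inv_sqrt_smul_of_norm_le (hC h)).congr fun N => ?_
  rw [poissonAverage_apply, poissonAverage_apply, map_smul, map_sum, ← smul_sub,
    ← Finset.sum_sub_distrib]

theorem asympIntertwines_shiftOp (hT : Λ.Relations k T) (hΛ : Λ.IsStepSFT k) (i : Fin d) :
    AsympIntertwines (poissonAverage hT) (Λ.shiftOp i) (T i) := by
  let x : H → ℕ → Λ.FockSpace ⊗[ℂ] H := fun h n =>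
    (Λ.shiftOp i).rTensor H (poissonPart Λ T n h) - poissonPart Λ T (n + 1) (T i h)
  refine asympIntertwines_poissonAverage hT
    (fun h => ∑ n ∈ Finset.range k, ‖x h n‖ + (‖T i h‖ + ‖T i h‖)) fun h N => ?_
  have h1 : ∑ n ∈ Finset.range (N + 1),
      ((Λ.shiftOp i).rTensor H (poissonPart Λ T n h) - poissonPart Λ T n (T i h)) =
      ∑ n ∈ Finset.range (N + 1), x h n +
        (poissonPart Λ T (N + 1) (T i h) - poissonPart Λ T 0 (T i h)) := by
    rw [← Finset.sum_range_sub (fun n => poissonPart Λ T n (T i h)), ← Finset.sum_add_distrib]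
    refine Finset.sum_congr rfl fun n _ => ?_
    simp only [x]
    abel
  rw [h1]
  refine (norm_add_le _ _).trans (add_le_add ?_ ?_)
  · refine norm_sum_range_le_of_eventually_zero (fun n hn => ?_) _
    exact sub_eq_zero.2 (rTensor_shiftOp_poissonPart hT hΛ i hn h)
  · refine (norm_sub_le _ _).trans ?_
    rw [norm_poissonPart hT, norm_poissonPart hT]

theorem asympIntertwines_star_shiftOp (hT : Λ.Relations k T) (i : Fin d) :
    AsympIntertwines (poissonAverage hT) (star (Λ.shiftOp i)) (star (T i)) := by
  refine asympIntertwines_poissonAverage hT (fun h => ‖star (T i) h‖) fun h N => ?_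
  rw [Finset.sum_sub_distrib, Finset.sum_range_succ', Finset.sum_range_succ,
    rTensor_star_shiftOp_poissonPart_zero]
  simp only [rTensor_star_shiftOp_poissonPart_succ hT]
  rw [add_zero, sub_add_cancel_left, norm_neg, norm_poissonPart hT]

theorem asympIntertwines_rankOne (hT : Λ.Relations k T) (u : Λ.FockSpace) (α : List (Fin d)) :
    AsympIntertwines (poissonAverage hT) (InnerProductSpace.rankOne ℂ u (Λ.basisVec α)) 0 := by
  classical
  let x : H → ℕ → Λ.FockSpace ⊗[ℂ] H := fun h n =>
    (InnerProductSpace.rankOne ℂ u (Λ.basisVec α)).rTensor H (poissonPart Λ T n h)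
  refine asympIntertwines_poissonAverage hT
    (fun h => ∑ n ∈ Finset.range (α.length + 1), ‖x h n‖) fun h N => ?_
  simp only [zero_apply, map_zero, sub_zero]
  refine norm_sum_range_le_of_eventually_zero (fun n hn => ?_) _
  rw [poissonPart_apply, map_sum]
  refine Finset.sum_eq_zero fun β hβ => ?_
  rw [ContinuousLinearMap.rTensor_tmul, InnerProductSpace.rankOne_apply, Λ.inner_basisVec, if_neg,
    zero_smul, zero_tmul]
  rintro ⟨rfl, -⟩
  have := mem_allWords.1 hβ
  omega

end Poisson

/-! ### Representations of the algebra of the subshift -/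

section Representations

variable {d : ℕ} (Λ : Subshift d)

theorem Subshift.relations_Z {k : ℕ} (hΛ : Λ.IsStepSFT k) : Λ.Relations k Λ.Z := by
  classical
  let S : Fin d → Λ.toeplitz := fun i => ⟨Λ.shiftOp i, Λ.shiftOp_mem_toeplitz i⟩
  let q : Λ.toeplitz →ₐ[ℂ] Λ.algebra := Ideal.Quotient.mkₐ ℂ Λ.compacts
  have hqS : ∀ i, q (S i) = Λ.Z i := fun _ => rfl
  have hq_star : ∀ a, q (star a) = star (q a) := fun _ => rfl
  have hqS' : ∀ α, q (wordProd S α) = wordProd Λ.Z α := fun α => map_wordProd S q α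
  have hS : ∀ α, ((wordProd S α : Λ.toeplitz) : Λ.FockSpace →L[ℂ] Λ.FockSpace) = wordProd Λ.shiftOp α :=
    fun α => by
      rw [show Λ.shiftOp = fun i => Λ.toeplitz.subtype (S i) from rfl, ← map_wordProd]
      rfl
  have hq : ∀ a b : Λ.toeplitz, IsCompactOperator (a - b : Λ.FockSpace →L[ℂ] Λ.FockSpace) →
      q a = q b := fun a b h => Ideal.Quotient.eq.2 h
  refine ⟨fun p hp => ?_, fun i j hij => ?_, ?_, fun i => ?_⟩
  · refine Λ.lift_eq_zero_of_mem_polyIdeal (fun α hα => ?_) hp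
    have h1 : wordProd S α = 0 := Subtype.ext ((hS α).trans (Λ.wordProd_shiftOp_of_notMem hα))
    rw [← hqS', h1, map_zero]
  · rw [← hqS, ← hqS, ← hq_star, ← map_mul]
    have h1 : star (S i) * S j = 0 := by
      refine Subtype.ext (Λ.ext_clm fun α => ?_)
      change star (Λ.shiftOp i) (Λ.shiftOp j (Λ.basisVec α)) = 0
      rw [Λ.shiftOp_basisVec, Λ.star_shiftOp_basisVec_cons, if_neg (fun h => hij h.1)]
    rw [h1, map_zero]
  · simp only [← hqS, ← hq_star, ← map_mul, ← map_sum]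
    rw [← map_one q]
    refine hq _ _ (Λ.isCompactOperator_of_basisVec (k := 1) fun α hα => ?_)
    obtain ⟨j, α, rfl⟩ := List.exists_cons_of_length_pos hα
    by_cases hadm : j :: α ∈ Λ.admissible
    swap
    · rw [Λ.basisVec_of_notMem hadm, map_zero]
    simp only [AddSubmonoidClass.coe_finsetSum, sub_apply, sum_apply]
    rw [Finset.sum_eq_single_of_mem j (Finset.mem_univ j)]
    · change Λ.shiftOp j (star (Λ.shiftOp j) (Λ.basisVec (j :: α))) - Λ.basisVec (j :: α) = 0
      rw [Λ.star_shiftOp_basisVec_cons, if_pos ⟨rfl, hadm⟩, Λ.shiftOp_basisVec, sub_self]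
    · intro i _ hij
      change Λ.shiftOp i (star (Λ.shiftOp i) (Λ.basisVec (j :: α))) = 0
      rw [Λ.star_shiftOp_basisVec_cons, if_neg (fun h => hij h.1), map_zero]
  · simp only [← hqS, ← hqS', ← hq_star, ← map_mul, ← map_sum]
    refine hq _ _ (Λ.isCompactOperator_of_basisVec (k := k) fun α hα => ?_)
    by_cases hadm : α ∈ Λ.admissible
    swap
    · rw [Λ.basisVec_of_notMem hadm, map_zero]
    have h1 : ∀ β, ((wordProd S β * star (wordProd S β) : Λ.toeplitz) :
        Λ.FockSpace →L[ℂ] Λ.FockSpace) (Λ.basisVec α) =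
          if β <+: α then Λ.basisVec α else 0 := by
      intro β
      rw [← Λ.wordProd_mul_star_basisVec, ← hS]
      rfl
    simp only [AddSubmonoidClass.coe_finsetSum, sub_apply, sum_apply, h1]
    change star (Λ.shiftOp i) (Λ.shiftOp i (Λ.basisVec α)) - _ = 0
    rw [Λ.shiftOp_basisVec, Λ.star_shiftOp_basisVec_cons, sub_eq_zero]
    -- the only word of length `k` that is a prefix of `α` is `α.take k`
    have h2 : ∀ β ∈ (Λ.finite_followers i k).toFinset,
        (if β <+: α then Λ.basisVec α else 0) = if β = α.take k then Λ.basisVec α else 0 := by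
      intro β hβ
      have hl : β.length = k := ((Λ.finite_followers i k).mem_toFinset.1 hβ).1.1
      simp only [List.prefix_iff_eq_take, hl]
    rw [Finset.sum_congr rfl h2, Finset.sum_ite_eq']
    simp only [Set.Finite.mem_toFinset, hΛ.take_mem_followers hadm hα, true_and]

variable {Λ} {H : Type*} [NormedAddCommGroup H] [InnerProductSpace ℂ H] [CompleteSpace H]

theorem Subshift.Relations.map {k : ℕ} {A B : Type*} [Ring A] [StarRing A] [Algebra ℂ A] [Ring B]
    [StarRing B] [Algebra ℂ B] {T : Fin d → A} (h : Λ.Relations k T) (π : A →⋆ₐ[ℂ] B) :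
    Λ.Relations k (fun i => π (T i)) where
  z1 := fun p hp => by
    refine Λ.lift_eq_zero_of_mem_polyIdeal (fun α hα => ?_) hp
    rw [← map_wordProd, h.wordProd_eq_zero hα, map_zero]
  z2 := fun i j hij => by rw [← map_star, ← map_mul, h.z2 i j hij, map_zero]
  z3 := by simp only [← map_star, ← map_mul, ← map_sum, h.z3, map_one]
  z4 := fun i => by simp only [← map_star, ← map_mul, ← map_wordProd, ← map_sum, h.z4 i]

/-- The quotient map `𝒯_X → 𝒪_Λ`. -/
def Subshift.quotientHom (Λ : Subshift d) : Λ.toeplitz →⋆ₐ[ℂ] Λ.algebra :=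
  { Ideal.Quotient.mkₐ ℂ Λ.compacts with map_star' := fun _ => rfl }

/-- Representations of the Toeplitz algebra are automatically continuous, since it is a
C⋆-algebra. -/
theorem Subshift.continuous_toeplitz_hom (ρ : Λ.toeplitz →⋆ₐ[ℂ] (H →L[ℂ] H)) : Continuous ρ := by
  have : IsClosed (Λ.toeplitz : Set (Λ.FockSpace →L[ℂ] Λ.FockSpace)) :=
    StarSubalgebra.isClosed_topologicalClosure _
  let _ : CStarAlgebra Λ.toeplitz := StarSubalgebra.cstarAlgebra Λ.toeplitz
  exact AddMonoidHomClass.continuous_of_bound ρ 1 fun a => by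
    simpa using NonUnitalStarAlgHom.norm_apply_le ρ a

theorem Subshift.hom_ext {π₁ π₂ : Λ.algebra →⋆ₐ[ℂ] (H →L[ℂ] H)}
    (h : ∀ i, π₁ (Λ.Z i) = π₂ (Λ.Z i)) : π₁ = π₂ := by
  have key : π₁.comp Λ.quotientHom = π₂.comp Λ.quotientHom := by
    refine StarAlgHom.ext_topologicalClosure (Λ.continuous_toeplitz_hom _)
      (Λ.continuous_toeplitz_hom _) (StarAlgHom.ext_adjoin ?_)
    rintro ⟨_, -⟩ ⟨i, rfl⟩
    exact h i
  refine StarAlgHom.ext fun x => ?_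
  obtain ⟨a, rfl⟩ := Ideal.Quotient.mk_surjective x
  exact DFunLike.congr_fun key a

/-- A representation of the Toeplitz algebra that kills the compact operators descends to `𝒪_Λ`. -/
theorem Subshift.exists_hom_of_toeplitz (ρ : Λ.toeplitz →⋆ₐ[ℂ] (H →L[ℂ] H))
    (hρ : ∀ a ∈ Λ.compacts, ρ a = 0) :
    ∃ π : Λ.algebra →⋆ₐ[ℂ] (H →L[ℂ] H),
      ∀ a, π (Ideal.Quotient.mk Λ.compacts a) = ρ a :=
  ⟨{ Ideal.Quotient.liftₐ Λ.compacts ρ.toAlgHom hρ with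
      map_star' := by
        rintro ⟨a⟩
        exact map_star ρ a }, fun _ => rfl⟩

end Representations

end SubshiftAlgebra

end

theorem mainTheorem11 {d : ℕ} (Λ : SubshiftAlgebra.Subshift d) (k : ℕ) (hΛ : Λ.IsStepSFT k)
    {H : Type*} [NormedAddCommGroup H] [InnerProductSpace ℂ H] [CompleteSpace H] :
    (∀ π : Λ.algebra →⋆ₐ[ℂ] (H →L[ℂ] H),
      SubshiftAlgebra.IsRowContraction (fun i => π (Λ.Z i)) ∧
        Λ.Relations k (fun i => π (Λ.Z i))) ∧
    (∀ π₁ π₂ : Λ.algebra →⋆ₐ[ℂ] (H →L[ℂ] H), (∀ i, π₁ (Λ.Z i) = π₂ (Λ.Z i)) → π₁ = π₂) ∧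
    (∀ T : Fin d → H →L[ℂ] H, SubshiftAlgebra.IsRowContraction T → Λ.Relations k T →
      ∃ π : Λ.algebra →⋆ₐ[ℂ] (H →L[ℂ] H), ∀ i, π (Λ.Z i) = T i) := by
  refine ⟨fun π => ?_, fun π₁ π₂ => SubshiftAlgebra.Subshift.hom_ext, fun T _ hT => ?_⟩
  · have h := (Λ.relations_Z hΛ).map π
    exact ⟨h.z3.le, h⟩
  · obtain ⟨ρ, hρ⟩ := SubshiftAlgebra.exists_hom_of_asympIntertwines
      (SubshiftAlgebra.poissonAverage hT) Λ.shiftOp T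
      (SubshiftAlgebra.asympIntertwines_shiftOp hT hΛ)
      (SubshiftAlgebra.asympIntertwines_star_shiftOp hT)
    -- an operator is asymptotically intertwined with at most one operator on `H`
    have unique : ∀ {a : Λ.toeplitz} {S : H →L[ℂ] H},
        SubshiftAlgebra.AsympIntertwines (SubshiftAlgebra.poissonAverage hT) a.1 S →
          ρ a = S := by
      intro a S hS
      have h1 := (hρ a).sub hS
      rw [sub_self] at h1
      exact sub_eq_zero.1 h1.eq_zero
    obtain ⟨π, hπ⟩ := SubshiftAlgebra.Subshift.exists_hom_of_toeplitz (Λ := Λ) ρ fun a ha =>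
      unique (SubshiftAlgebra.asympIntertwines_zero_of_isCompactOperator Λ.dense_span_basisVec
        (SubshiftAlgebra.asympIntertwines_rankOne hT) ha)
    exact ⟨π, fun i => (hπ _).trans
      (unique (SubshiftAlgebra.asympIntertwines_shiftOp hT hΛ i))⟩
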